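/- Let $n\ge 1$. Permutations $P$ of $\{0,1,\dots,n+1\}$ are considered in which $0$ is the first and $n+1$ the last element. A directed MinMax-profile $F$ on $\{0,1,\dots,n+1\}$ assigns to each $t$ with $0\le t\le n$ integers $m_t,M_t$ with $0\le m_t\le t<t+1\le M_t\le n+1$, and a direction, which says whether $t$ is to be on the left of $t+1$ or $t+1$ on the left of $t$. $F$ is the directed MinMax-profile of $P$ if for each $t$ with $0\le t\le n$, the smallest and the largest element in the interval of $P$ delimited by $t$ and $t+1$ (both included) are $m_t$ and $M_t$, and the relative position of $t$ and $t+1$ on $P$ is the one given by $F$. $F$ is linear if the intervals $[m_t..M_t]=\{x\in\mathbb Z: m_t\le x\le M_t\}$, $1\le t\le n-1$, are totally ordered by inclusion. Directed MinMax-Betweenness is the problem of deciding, given $n$ and a directed MinMax-profile $F$ on $\{0,1,\dots,n+1\}$, whether there is a permutation $P$ whose directed MinMax-profile is $F$. Theorem. Directed MinMax-Betweenness is decidable in polynomial time for linear profiles: there are an algorithm (a program for a random-access machine with addition and subtraction, each operation and each test costing one time unit) and a polynomial $q$ such that for all $n\ge 1$ and all linear directed MinMax-profiles $F$ on $\{0,1,\dots,n+1\}$,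 the algorithm halts on the input $(n,F)$ after at most $q(n)$ steps and answers correctly whether $F$ is the directed MinMax-profile of some permutation. -/

import Mathlib

/-! ### Directed MinMax-profiles -/

/-- A directed MinMax-profile on `[n] ∪ {0, n+1} = {0, …, n+1}`: for every `t` with `0 ≤ t ≤ n`,
a constraint on the pair `t, t+1` (here `t.castSucc`, `t.succ`) that consists of two elements
`lo t = m_t` and `hi t = M_t` with `0 ≤ m_t ≤ t < t+1 ≤ M_t ≤ n+1`, and of the relative position
of `t` and `t+1`: `fwd t` is `true` if `t` is required to be on the left of `t+1`, and `false` if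
`t+1` is required to be on the left of `t`. -/
structure DirectedProfile (n : ℕ) where
  lo : Fin (n + 1) → Fin (n + 2)
  hi : Fin (n + 1) → Fin (n + 2)
  fwd : Fin (n + 1) → Bool
  lo_le : ∀ t, lo t ≤ t.castSucc
  le_hi : ∀ t, t.succ ≤ hi t

/-- A permutation on `[n] ∪ {0, n+1}`, as a bijection from positions to elements (`seq i` is the
element at position `i`, and `seq.symm x` is the position of the element `x`), with `0` fixed at the
beginning and `n+1` fixed at the end. -/
structure ExtPerm (n : ℕ) where
  seq : Equiv.Perm (Fin (n + 2))
  seq_zero : seq 0 = 0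
  seq_last : seq (Fin.last (n + 1)) = Fin.last (n + 1)

namespace ExtPerm

variable {n : ℕ}

/-- The elements located in the interval delimited on `P` by the elements `a` and `b`, both
included, whichever of the two is on the left. -/
def between (P : ExtPerm n) (a b : Fin (n + 2)) : Set (Fin (n + 2)) :=
  {x | P.seq.symm x ∈ Set.uIcc (P.seq.symm a) (P.seq.symm b)}

/-- `F` is the directed MinMax-profile of the permutation `P`: for every `t`, `0 ≤ t ≤ n`, the
minimum and the maximum of the interval delimited on `P` by `t` and `t+1` are `m_t` and `M_t`, and
the relative position of `t` and `t+1` on `P` is the one given by `F`. -/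
def HasProfile (P : ExtPerm n) (F : DirectedProfile n) : Prop :=
  ∀ t : Fin (n + 1),
    IsLeast (P.between t.castSucc t.succ) (F.lo t) ∧
    IsGreatest (P.between t.castSucc t.succ) (F.hi t) ∧
    (F.fwd t = true ↔ P.seq.symm t.castSucc < P.seq.symm t.succ)

end ExtPerm

namespace DirectedProfile

variable {n : ℕ}

/-- The question of Directed MinMax-Betweenness. -/
def IsRealizable (F : DirectedProfile n) : Prop :=
  ∃ P : ExtPerm n, P.HasProfile F

/-- `F` is linear: the intervals `[m_t..M_t]`, `1 ≤ t ≤ n-1`, are totally ordered by inclusion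
(the inclusion of sets is always a partial order; the intervals of distinct `t` may coincide). -/
def IsLinear (F : DirectedProfile n) : Prop :=
  ∀ s t : Fin (n + 1), 1 ≤ s.val → s.val < n → 1 ≤ t.val → t.val < n →
    Set.Icc (F.lo s) (F.hi s) ⊆ Set.Icc (F.lo t) (F.hi t) ∨
    Set.Icc (F.lo t) (F.hi t) ⊆ Set.Icc (F.lo s) (F.hi s)

end DirectedProfile

/-! ### A random-access machine with a step count

Programs use finitely many variables (`reg 0`, `reg 1`, …) and finitely many one-dimensional arrays
(`arr 0`, `arr 1`, …), all holding natural numbers. The arithmetic instructions are only addition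
and truncated subtraction, so that a number grows by at most one bit per step, and counting one
time unit per instruction and per test defines the same polynomial time as Turing machines. -/

namespace RAM

/-- The contents of the variables and of the arrays. -/
structure Store where
  reg : ℕ → ℕ
  arr : ℕ → ℕ → ℕ

namespace Store

/-- Assignment of the value `v` to the variable `x`. -/
def setReg (s : Store) (x v : ℕ) : Store :=
  { s with reg := Function.update s.reg x v }

/-- Assignment of the value `v` to the `i`-th entry of the array `a`. -/
def setArr (s : Store) (a i v : ℕ) : Store :=
  { s with arr := Function.update s.arr a (Function.update (s.arr a) i v) }

end Store

/-- Programs. In the comments, `x`, `y`, `z`, `i` name variables, and `a` names an array. -/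
inductive Prog where
  /-- `x := v`, for a constant `v` -/
  | const (x v : ℕ)
  /-- `x := y + z` -/
  | add (x y z : ℕ)
  /-- `x := y - z`, truncated at `0` -/
  | sub (x y z : ℕ)
  /-- `x := a[i]` -/
  | load (x a i : ℕ)
  /-- `a[i] := x` -/
  | store (a i x : ℕ)
  /-- `p; q` -/
  | seq (p q : Prog)
  /-- if `x ≠ 0` then `p` else `q` -/
  | ite (x : ℕ) (p q : Prog)
  /-- while `x ≠ 0` do `p` -/
  | loop (x : ℕ) (p : Prog)

/-- A configuration: the list of the programs that remain to be executed, one after the other, and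
the current store. The machine has halted when the list is empty. -/
abbrev Config : Type := List Prog × Store

/-- One step of the machine. -/
def step : Config → Config
  | ([], s) => ([], s)
  | (.const x v :: k, s) => (k, s.setReg x v)
  | (.add x y z :: k, s) => (k, s.setReg x (s.reg y + s.reg z))
  | (.sub x y z :: k, s) => (k, s.setReg x (s.reg y - s.reg z))
  | (.load x a i :: k, s) => (k, s.setReg x (s.arr a (s.reg i)))
  | (.store a i x :: k, s) => (k, s.setArr a (s.reg i) (s.reg x))
  | (.seq p q :: k, s) => (p :: q :: k, s)
  | (.ite x p q :: k, s) => if s.reg x ≠ 0 then (p :: k, s) else (q :: k, s)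
  | (.loop x p :: k, s) => if s.reg x ≠ 0 then (p :: .loop x p :: k, s) else (k, s)

/-- Started on the store `s`, the program `p` halts after at most `T` steps and answers the
question `Q` correctly: the variable `reg 0` finally holds `1` if `Q` is true, `0` if it is false. -/
def DecidesWithin (p : Prog) (s : Store) (T : ℕ) (Q : Prop) : Prop :=
  ∃ k ≤ T, ∃ s' : Store, step^[k] ([p], s) = ([], s') ∧
    ((Q ∧ s'.reg 0 = 1) ∨ (¬ Q ∧ s'.reg 0 = 0))

end RAM

/-- The machine input that presents `n` and the directed profile `F`: the variable `reg 0` holds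
`n`, and for `0 ≤ t ≤ n` the `t`-th entries of the arrays `arr 0`, `arr 1`, `arr 2` hold
`m_t`, `M_t` and the direction (`1` if `t` is on the left of `t+1`, else `0`). All else is `0`. -/
def DirectedProfile.encode {n : ℕ} (F : DirectedProfile n) : RAM.Store where
  reg x := if x = 0 then n else 0
  arr a t :=
    if h : t < n + 1 then
      if a = 0 then (F.lo ⟨t, h⟩).val
      else if a = 1 then (F.hi ⟨t, h⟩).val
      else if a = 2 then (F.fwd ⟨t, h⟩).toNat
      else 0
    else 0

/-! Read a profile as conditions on the weak position order of the permutation sought. Endpoints,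
minima and maxima give facts. An element `z` outside `[m_t..M_t]` must not lie between the left and
the right one of `t`, `t+1`: if it is after the left one it is after the right one, and if it is
before the right one it is before the left one. With reflexivity and transitivity all these are Horn
clauses, so there is a least relation `Forced` satisfying them. If `Forced` is not antisymmetric, no
permutation exists.

Linearity gives the converse (`isRealizable_iff_forced_antisymm`). Take a maximal antisymmetric
closed relation and suppose that some pairs `(t, z)` are still undecided. Among them choose `(e, x)`
with the interval of `e` maximal under inclusion. No interval containing `x` raises an undecided
constraint: it would be comparable with the interval of `e`, and then either inclusion puts `x` into
the latter. Hence the down-set of `x` can be placed before everything else without violating a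
clause (`ordinalSum`), and this decides `(e, x)`, against maximality. So nothing is undecided, and
every linear extension is a permutation with the given profile (`isRealizable_of_decided`).

It remains to compute `Forced` on the machine by forward chaining. Precedences are numbers below
`(n+2)^2`, and that number itself stands for a contradiction. A sweep over all triples applies every
clause; until the marked set is a model, each sweep adds a mark, so polynomially many sweeps suffice
(`Pass.saturate`). -/

namespace DirectedProfile

variable {n : ℕ}

/-! ### The Horn clauses of a profile -/

/-- The left one of `t` and `t+1`, according to `F`. -/
def src (F : DirectedProfile n) (t : Fin (n + 1)) : Fin (n + 2) :=
  if F.fwd t then t.castSucc else t.succ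

/-- The right one of `t` and `t+1`, according to `F`. -/
def tgt (F : DirectedProfile n) (t : Fin (n + 1)) : Fin (n + 2) :=
  if F.fwd t then t.succ else t.castSucc

/-- The relation `r` (read `r x y` as: `x` is weakly on the left of `y`) satisfies the Horn clauses
that the weak position order of every permutation with profile `F` satisfies. -/
structure IsClosed (F : DirectedProfile n) (r : Fin (n + 2) → Fin (n + 2) → Prop) : Prop where
  refl : ∀ x, r x x
  zero : ∀ x, r 0 x
  last : ∀ x, r x (Fin.last (n + 1))
  src_lo : ∀ t, r (F.src t) (F.lo t)
  lo_tgt : ∀ t, r (F.lo t) (F.tgt t)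
  src_hi : ∀ t, r (F.src t) (F.hi t)
  hi_tgt : ∀ t, r (F.hi t) (F.tgt t)
  trans : ∀ x y z, r x y → r y z → r x z
  right : ∀ t z, z ∉ Set.Icc (F.lo t) (F.hi t) → r (F.src t) z → r (F.tgt t) z
  left : ∀ t z, z ∉ Set.Icc (F.lo t) (F.hi t) → r z (F.tgt t) → r z (F.src t)

/-- The least relation that satisfies `IsClosed F`. -/
def Forced (F : DirectedProfile n) (x y : Fin (n + 2)) : Prop :=
  ∀ r, F.IsClosed r → r x y

/-- Horn clauses pass to intersections, so the intersection of all closed relations is closed. -/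
theorem isClosed_forced (F : DirectedProfile n) : F.IsClosed F.Forced where
  refl x _ h := h.refl x
  zero x _ h := h.zero x
  last x _ h := h.last x
  src_lo t _ h := h.src_lo t
  lo_tgt t _ h := h.lo_tgt t
  src_hi t _ h := h.src_hi t
  hi_tgt t _ h := h.hi_tgt t
  trans x y z h₁ h₂ r h := h.trans x y z (h₁ r h) (h₂ r h)
  right t z hz h₁ r h := h.right t z hz (h₁ r h)
  left t z hz h₁ r h := h.left t z hz (h₁ r h)

theorem src_mem (F : DirectedProfile n) (t : Fin (n + 1)) :
    F.src t ∈ Set.Icc (F.lo t) (F.hi t) := by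
  have h₁ := F.lo_le t
  have h₂ := F.le_hi t
  have h₃ : t.castSucc < t.succ := Fin.castSucc_lt_succ
  unfold src
  split
  · exact ⟨h₁, h₃.le.trans h₂⟩
  · exact ⟨h₁.trans h₃.le, h₂⟩

theorem tgt_mem (F : DirectedProfile n) (t : Fin (n + 1)) :
    F.tgt t ∈ Set.Icc (F.lo t) (F.hi t) := by
  have h₁ := F.lo_le t
  have h₂ := F.le_hi t
  have h₃ : t.castSucc < t.succ := Fin.castSucc_lt_succ
  unfold tgt
  split
  · exact ⟨h₁.trans h₃.le, h₂⟩
  · exact ⟨h₁, h₃.le.trans h₂⟩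

theorem src_ne_tgt (F : DirectedProfile n) (t : Fin (n + 1)) : F.src t ≠ F.tgt t := by
  have h₃ : t.castSucc < t.succ := Fin.castSucc_lt_succ
  unfold src tgt
  split
  · exact h₃.ne
  · exact h₃.ne'

theorem between_eq (F : DirectedProfile n) (P : ExtPerm n) (t : Fin (n + 1))
    (h : P.seq.symm (F.src t) ≤ P.seq.symm (F.tgt t)) :
    P.between t.castSucc t.succ =
      {x | P.seq.symm (F.src t) ≤ P.seq.symm x ∧ P.seq.symm x ≤ P.seq.symm (F.tgt t)} := by
  unfold src tgt at *
  unfold ExtPerm.between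
  split at h
  · simp only [*, if_true, Set.uIcc_of_le h]; rfl
  · simp only [*, Set.uIcc_of_ge h]; rfl

theorem src_lt_tgt_iff (F : DirectedProfile n) (P : ExtPerm n) (t : Fin (n + 1)) :
    P.seq.symm (F.src t) < P.seq.symm (F.tgt t) ↔
      (F.fwd t = true ↔ P.seq.symm t.castSucc < P.seq.symm t.succ) := by
  have h₃ : P.seq.symm t.castSucc ≠ P.seq.symm t.succ :=
    fun h => Fin.castSucc_lt_succ.ne (P.seq.symm.injective h)
  unfold src tgt
  rcases lt_or_gt_of_ne h₃ with h | h
  · cases hF : F.fwd t <;> simp [h, h.le]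
  · cases hF : F.fwd t <;> simp [h, h.le]

/-- The weak position order of a permutation with profile `F` satisfies the Horn clauses. -/
theorem isClosed_of_hasProfile {F : DirectedProfile n} {P : ExtPerm n} (hP : P.HasProfile F) :
    F.IsClosed fun x y => P.seq.symm x ≤ P.seq.symm y := by
  have hlt : ∀ t, P.seq.symm (F.src t) < P.seq.symm (F.tgt t) := fun t =>
    (F.src_lt_tgt_iff P t).2 (hP t).2.2
  have hlo : ∀ t, P.seq.symm (F.src t) ≤ P.seq.symm (F.lo t) ∧
      P.seq.symm (F.lo t) ≤ P.seq.symm (F.tgt t) := fun t => by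
    have := (hP t).1.1
    rwa [F.between_eq P t (hlt t).le] at this
  have hhi : ∀ t, P.seq.symm (F.src t) ≤ P.seq.symm (F.hi t) ∧
      P.seq.symm (F.hi t) ≤ P.seq.symm (F.tgt t) := fun t => by
    have := (hP t).2.1.1
    rwa [F.between_eq P t (hlt t).le] at this
  have hout : ∀ t z, z ∉ Set.Icc (F.lo t) (F.hi t) → P.seq.symm (F.src t) ≤ P.seq.symm z →
      P.seq.symm z ≤ P.seq.symm (F.tgt t) → False := fun t z hz h₁ h₂ => by
    have : z ∈ P.between t.castSucc t.succ := by
      rw [F.between_eq P t (hlt t).le]; exact ⟨h₁, h₂⟩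
    exact hz ⟨(hP t).1.2 this, (hP t).2.1.2 this⟩
  refine ⟨fun _ => le_rfl, fun x => ?_, fun x => ?_, fun t => (hlo t).1, fun t => (hlo t).2,
    fun t => (hhi t).1, fun t => (hhi t).2, fun _ _ _ => le_trans, fun t z hz h => ?_,
    fun t z hz h => ?_⟩
  · rw [P.seq.symm_apply_eq.2 P.seq_zero.symm]; exact Fin.zero_le _
  · rw [P.seq.symm_apply_eq.2 P.seq_last.symm]; exact Fin.le_last _
  · exact le_of_not_ge fun h' => hout t z hz h h'
  · exact le_of_not_ge fun h' => hout t z hz h' h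

/-! ### Extending a closed relation until every constraint is decided -/

namespace IsClosed

variable {F : DirectedProfile n} {r : Fin (n + 2) → Fin (n + 2) → Prop}

theorem src_tgt (h : F.IsClosed r) (t : Fin (n + 1)) : r (F.src t) (F.tgt t) :=
  h.trans _ _ _ (h.src_lo t) (h.lo_tgt t)

/-- The constraints of the pairs `0, 1` and `n, n+1` are decided in every closed relation. -/
theorem comparable_of_boundary (h : F.IsClosed r) {t : Fin (n + 1)}
    (ht : ¬ (1 ≤ t.val ∧ t.val < n)) {z : Fin (n + 2)} (hz : z ∉ Set.Icc (F.lo t) (F.hi t)) :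
    r (F.src t) z ∨ r z (F.src t) := by
  have ht' : t.castSucc = 0 ∨ t.succ = Fin.last (n + 1) := by
    have := t.isLt
    simp only [Fin.ext_iff, Fin.val_castSucc, Fin.val_zero, Fin.val_succ, Fin.val_last]
    omega
  -- If 0 is the left element, it precedes `z`; if 0 is the right one, the left one precedes `z`
  -- through it. If `n+1` is the left element, `z` precedes it; if it is the right one, `z` precedes
  -- the left one by the clause `left`.
  have hst := h.src_tgt t
  have hl := h.left t z hz
  have h0 := h.zero z
  have h1 := h.last z
  have htr := h.trans (F.src t) (F.tgt t) z hst
  unfold src tgt at *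
  rcases ht' with e | e <;> split <;> simp_all

/-- `z` is outside of the interval of `t` and not yet placed relatively to `t` and `t+1`. -/
def Undecided (F : DirectedProfile n) (r : Fin (n + 2) → Fin (n + 2) → Prop) (t : Fin (n + 1))
    (z : Fin (n + 2)) : Prop :=
  z ∉ Set.Icc (F.lo t) (F.hi t) ∧ ¬ r (F.src t) z ∧ ¬ r z (F.src t)

/-- Placing the elements weakly on the left of `x` before all others keeps a relation closed, if
the intervals that contain `x` raise no undecided constraint. -/
theorem ordinalSum (h : F.IsClosed r) {x : Fin (n + 2)}
    (hx : ∀ t z, x ∈ Set.Icc (F.lo t) (F.hi t) → ¬ Undecided F r t z) :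
    F.IsClosed fun a b => r a b ∨ (r a x ∧ ¬ r b x) := by
  -- A pair separated by the down-set of `x` has `x` in its interval, so the hypothesis `hx` decides
  -- all its constraints. Only such pairs could be harmed by the new precedences.
  have hin : ∀ t, r (F.src t) x → ¬ r (F.tgt t) x → x ∈ Set.Icc (F.lo t) (F.hi t) :=
    fun t h₁ h₂ => by_contra fun h₃ => h₂ (h.right t x h₃ h₁)
  have hcmp : ∀ t z, z ∉ Set.Icc (F.lo t) (F.hi t) → r (F.src t) x → ¬ r (F.tgt t) x →
      r (F.src t) z ∨ r z (F.src t) := fun t z hz h₁ h₂ => by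
    have := hx t z (hin t h₁ h₂)
    unfold Undecided at this
    tauto
  refine ⟨fun y => .inl (h.refl y), fun y => .inl (h.zero y), fun y => .inl (h.last y),
    fun t => .inl (h.src_lo t), fun t => .inl (h.lo_tgt t), fun t => .inl (h.src_hi t),
    fun t => .inl (h.hi_tgt t), ?_, ?_, ?_⟩
  · rintro a b c (hab | ⟨ha, hb⟩) (hbc | ⟨hb', hc⟩)
    · exact .inl (h.trans _ _ _ hab hbc)
    · exact .inr ⟨h.trans _ _ _ hab hb', hc⟩
    · exact .inr ⟨ha, fun hc => hb (h.trans _ _ _ hbc hc)⟩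
    · exact absurd hb' hb
  · rintro t z hz (h₁ | ⟨h₁, h₂⟩)
    · exact .inl (h.right t z hz h₁)
    by_cases h₃ : r (F.tgt t) x
    · exact .inr ⟨h₃, h₂⟩
    rcases hcmp t z hz h₁ h₃ with h₄ | h₄
    · exact .inl (h.right t z hz h₄)
    · exact absurd (h.trans _ _ _ h₄ h₁) h₂
  · rintro t z hz (h₁ | ⟨h₁, h₂⟩)
    · exact .inl (h.left t z hz h₁)
    by_cases h₃ : r (F.src t) x
    · rcases hcmp t z hz h₃ h₂ with h₄ | h₄
      · exact absurd (h.trans _ _ _ (h.right t z hz h₄) h₁) h₂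
      · exact .inl h₄
    · exact .inr ⟨h₁, h₃⟩

/-- For a linear profile, an undecided constraint can be chosen such that no interval that contains
its element raises an undecided constraint. -/
theorem exists_maximal_undecided (h : F.IsClosed r) (hF : F.IsLinear) {t : Fin (n + 1)}
    {z : Fin (n + 2)} (htz : Undecided F r t z) :
    ∃ e x, Undecided F r e x ∧
      ∀ t z, x ∈ Set.Icc (F.lo t) (F.hi t) → ¬ Undecided F r t z := by
  have hint : ∀ t z, Undecided F r t z → 1 ≤ t.val ∧ t.val < n := fun t z ⟨h₁, h₂, h₃⟩ => by
    by_contra ht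
    exact (h.comparable_of_boundary ht h₁).elim h₂ h₃
  let S : Set (Set (Fin (n + 2))) :=
    {J | ∃ e x, Undecided F r e x ∧ J = Set.Icc (F.lo e) (F.hi e)}
  obtain ⟨J, ⟨e, x, hex, rfl⟩, hmax⟩ :=
    (Set.toFinite S).exists_maximal ⟨_, t, z, htz, rfl⟩
  -- If an interval containing `x` raised an undecided constraint, it would lie inside that of `e`,
  -- by linearity or by maximality; but `x` is outside the interval of `e`.
  refine ⟨e, x, hex, fun f y hxf hfy => ?_⟩
  obtain ⟨e₁, e₂⟩ := hint e x hex
  obtain ⟨f₁, f₂⟩ := hint f y hfy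
  rcases hF e f e₁ e₂ f₁ f₂ with hef | hfe
  · exact hex.1 (hmax ⟨f, y, hfy, rfl⟩ hef hxf)
  · exact hex.1 (hfe hxf)

/-- For a linear profile, an antisymmetric closed relation is contained in one without undecided
constraints. -/
theorem exists_decided (h : F.IsClosed r) (hr : ∀ x y, r x y → r y x → x = y)
    (hF : F.IsLinear) :
    ∃ r' : Fin (n + 2) → Fin (n + 2) → Prop, F.IsClosed r' ∧
      (∀ x y, r' x y → r' y x → x = y) ∧ ∀ t z, ¬ Undecided F r' t z := by
  let S : Set (Fin (n + 2) → Fin (n + 2) → Prop) :=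
    {r | F.IsClosed r ∧ ∀ x y, r x y → r y x → x = y}
  obtain ⟨r', ⟨hc, ha⟩, hmax⟩ := (Set.toFinite S).exists_maximal ⟨r, h, hr⟩
  refine ⟨r', hc, ha, fun t z htz => ?_⟩
  obtain ⟨e, x, hex, hx⟩ := hc.exists_maximal_undecided hF htz
  -- By maximality the ordinal sum adds nothing to `r'`; yet it puts `x` before the left element of
  -- `e`, which `r'` does not.
  have hle := hmax (y := fun a b => r' a b ∨ (r' a x ∧ ¬ r' b x))
    ⟨hc.ordinalSum hx, ?_⟩ fun a b hab => Or.inl hab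
  · exact hex.2.2 (hle x (F.src e) (.inr ⟨hc.refl x, hex.2.1⟩))
  · rintro a b (hab | ⟨ha', hb⟩) (hba | ⟨hb', ha''⟩)
    · exact ha a b hab hba
    · exact absurd (hc.trans _ _ _ hab hb') ha''
    · exact absurd (hc.trans _ _ _ hba ha') hb
    · exact absurd hb' hb

end IsClosed

/-! ### From a decided relation to a permutation -/

/-- A linear order on a finite type is the order of an enumeration. -/
theorem exists_equiv_fin_of_isLinearOrder {α : Type*} [Fintype α] (s : α → α → Prop)
    [IsLinearOrder α s] {k : ℕ} (hk : Fintype.card α = k) :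
    ∃ e : α ≃ Fin k, ∀ a b, s a b ↔ e a ≤ e b := by
  classical
  let : LinearOrder α :=
    { le := s
      le_refl := refl_of s
      le_trans := fun _ _ _ => trans_of s
      le_antisymm := fun _ _ => antisymm_of s
      le_total := total_of s
      toDecidableLE := Classical.decRel _ }
  exact ⟨(Fintype.orderIsoFinOfCardEq α hk).symm.toEquiv,
    fun a b => ((Fintype.orderIsoFinOfCardEq α hk).symm.le_iff_le (x := a) (y := b)).symm⟩

/-- Once no constraint is undecided, each outside element is provably on one side of each pair, so
an arbitrary linear extension keeps it there. -/
theorem isRealizable_of_decided {F : DirectedProfile n} {r : Fin (n + 2) → Fin (n + 2) → Prop}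
    (h : F.IsClosed r) (hr : ∀ x y, r x y → r y x → x = y)
    (hd : ∀ t z, ¬ IsClosed.Undecided F r t z) : F.IsRealizable := by
  have : IsPartialOrder (Fin (n + 2)) r :=
    { refl := h.refl, trans := h.trans, antisymm := hr }
  obtain ⟨s, hs, hrs⟩ := extend_partialOrder r
  obtain ⟨e, he⟩ := exists_equiv_fin_of_isLinearOrder s (Fintype.card_fin (n + 2))
  have hre : ∀ {x y}, r x y → e x ≤ e y := fun hxy => (he _ _).1 (hrs _ _ hxy)
  let P : ExtPerm n :=
    { seq := e.symm
      seq_zero := by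
        rw [Equiv.symm_apply_eq]
        exact le_antisymm (Fin.zero_le _) (by simpa using hre (h.zero (e.symm 0)))
      seq_last := by
        rw [Equiv.symm_apply_eq]
        exact le_antisymm (by simpa using hre (h.last (e.symm (Fin.last (n + 1)))))
          (Fin.le_last _) }
  have hP : ∀ x, P.seq.symm x = e x := fun x => rfl
  refine ⟨P, fun t => ?_⟩
  have hst := hre (h.src_tgt t)
  have hlt : P.seq.symm (F.src t) < P.seq.symm (F.tgt t) :=
    lt_of_le_of_ne hst fun h' => F.src_ne_tgt t (e.injective h')
  have hout : ∀ z ∈ P.between t.castSucc t.succ, z ∈ Set.Icc (F.lo t) (F.hi t) := fun z hz => by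
    rw [F.between_eq P t hlt.le] at hz
    by_contra hz'
    have hd' := hd t z
    unfold IsClosed.Undecided at hd'
    have : r (F.src t) z ∨ r z (F.src t) := by tauto
    rcases this with h₁ | h₁
    · have := e.injective (le_antisymm (hre (h.right t z hz' h₁)) hz.2)
      exact hz' (this ▸ F.tgt_mem t)
    · have := e.injective (le_antisymm (hre h₁) hz.1)
      exact hz' (this ▸ F.src_mem t)
  refine ⟨⟨?_, fun z hz => (hout z hz).1⟩, ⟨?_, fun z hz => (hout z hz).2⟩,
    (F.src_lt_tgt_iff P t).1 hlt⟩
  · rw [F.between_eq P t hlt.le]; exact ⟨hre (h.src_lo t), hre (h.lo_tgt t)⟩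
  · rw [F.between_eq P t hlt.le]; exact ⟨hre (h.src_hi t), hre (h.hi_tgt t)⟩

/-- A linear profile is realizable if and only if the precedences that the Horn clauses force are
free of contradictions. -/
theorem isRealizable_iff_forced_antisymm {F : DirectedProfile n} (hF : F.IsLinear) :
    F.IsRealizable ↔ ∀ x y, F.Forced x y → F.Forced y x → x = y := by
  constructor
  · rintro ⟨P, hP⟩ x y hxy hyx
    have hc := isClosed_of_hasProfile hP
    exact P.seq.symm.injective (le_antisymm (hxy _ hc) (hyx _ hc))
  · intro h
    obtain ⟨r, h₁, h₂, h₃⟩ := F.isClosed_forced.exists_decided h hF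
    exact isRealizable_of_decided h₁ h₂ h₃

end DirectedProfile

/-! ### Running times of programs and of bounded loops -/

namespace RAM

/-- Started on `s`, the program `p` ends after at most `T` steps on the store `s'`, whatever remains
to be executed afterwards. -/
def Runs (p : Prog) (s s' : Store) (T : ℕ) : Prop :=
  ∃ k ≤ T, ∀ K : List Prog, step^[k] (p :: K, s) = (K, s')

namespace Runs

theorem mono {p : Prog} {s s' : Store} {T T' : ℕ} (h : Runs p s s' T) (hT : T ≤ T') :
    Runs p s s' T' := by
  obtain ⟨k, hk, h⟩ := h
  exact ⟨k, hk.trans hT, h⟩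

theorem const (x v : ℕ) (s : Store) : Runs (.const x v) s (s.setReg x v) 1 :=
  ⟨1, le_rfl, fun _ => rfl⟩

theorem add (x y z : ℕ) (s : Store) :
    Runs (.add x y z) s (s.setReg x (s.reg y + s.reg z)) 1 :=
  ⟨1, le_rfl, fun _ => rfl⟩

theorem sub (x y z : ℕ) (s : Store) :
    Runs (.sub x y z) s (s.setReg x (s.reg y - s.reg z)) 1 :=
  ⟨1, le_rfl, fun _ => rfl⟩

theorem load (x a i : ℕ) (s : Store) :
    Runs (.load x a i) s (s.setReg x (s.arr a (s.reg i))) 1 :=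
  ⟨1, le_rfl, fun _ => rfl⟩

theorem store (a i x : ℕ) (s : Store) :
    Runs (.store a i x) s (s.setArr a (s.reg i) (s.reg x)) 1 :=
  ⟨1, le_rfl, fun _ => rfl⟩

/-- A step followed by a run. -/
theorem of_step {p q : Prog} {s s' : Store} {T : ℕ}
    (hs : ∀ K, step (p :: K, s) = (q :: K, s)) (h : Runs q s s' T) : Runs p s s' (T + 1) := by
  obtain ⟨k, hk, h⟩ := h
  exact ⟨k + 1, by omega, fun K => by rw [Function.iterate_succ_apply, hs, h]⟩

theorem seq {p q : Prog} {s s' s'' : Store} {T T' : ℕ} (h : Runs p s s' T)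
    (h' : Runs q s' s'' T') : Runs (.seq p q) s s'' (T' + T + 1) := by
  obtain ⟨k, hk, h⟩ := h
  obtain ⟨k', hk', h'⟩ := h'
  refine ⟨k' + k + 1, by omega, fun K => ?_⟩
  rw [Function.iterate_succ_apply, Function.iterate_add_apply]
  exact (congrArg _ (h (q :: K))).trans (h' K)

theorem ite_of_ne {x : ℕ} {p q : Prog} {s s' : Store} {T : ℕ} (hx : s.reg x ≠ 0)
    (h : Runs p s s' T) : Runs (.ite x p q) s s' (T + 1) :=
  of_step (fun _ => if_pos hx) h

theorem ite_of_eq {x : ℕ} {p q : Prog} {s s' : Store} {T : ℕ} (hx : s.reg x = 0)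
    (h : Runs q s s' T) : Runs (.ite x p q) s s' (T + 1) :=
  of_step (fun _ => if_neg (not_not.2 hx)) h

theorem loop_of_eq {x : ℕ} {p : Prog} {s : Store} (hx : s.reg x = 0) :
    Runs (.loop x p) s s 1 :=
  ⟨1, le_rfl, fun _ => if_neg (not_not.2 hx)⟩

theorem loop_of_ne {x : ℕ} {p : Prog} {s s' s'' : Store} {T T' : ℕ} (hx : s.reg x ≠ 0)
    (h : Runs p s s' T) (h' : Runs (.loop x p) s' s'' T') :
    Runs (.loop x p) s s'' (T' + T + 1) := by
  obtain ⟨k, hk, h⟩ := h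
  obtain ⟨k', hk', h'⟩ := h'
  refine ⟨k' + k + 1, by omega, fun K => ?_⟩
  rw [Function.iterate_succ_apply, Function.iterate_add_apply]
  have : step (.loop x p :: K, s) = (p :: .loop x p :: K, s) := if_pos hx
  rw [this, h, h']

end Runs

/-- `for i := reg c - 1` down to `0` do `p`, where `reg 2` holds `1` and `reg 3` holds `0`. -/
def forDown (i c : ℕ) (p : Prog) : Prog :=
  .seq (.add i c 3) (.loop i (.seq (.sub i i 2) p))

/-- The rule for bounded loops: `Inv v` holds when the iterations `m-1, …, v` have been made. -/
theorem runs_forDown {i c m T : ℕ} {p : Prog} {s : Store} (Inv : ℕ → Store → Prop)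
    (hs3 : s.reg 3 = 0) (hc : s.reg c = m) (h0 : Inv m (s.setReg i m))
    (h2 : ∀ v s, Inv v s → s.reg 2 = 1)
    (hp : ∀ v < m, ∀ s, Inv (v + 1) s → s.reg i = v + 1 →
      ∃ s', Runs p (s.setReg i v) s' T ∧ Inv v s' ∧ s'.reg i = v) :
    ∃ s', Runs (forDown i c p) s s' (m * (T + 3) + 3) ∧ Inv 0 s' := by
  have key : ∀ v ≤ m, ∀ s, Inv v s → s.reg i = v →
      ∃ s', Runs (.loop i (.seq (.sub i i 2) p)) s s' (v * (T + 3) + 1) ∧ Inv 0 s' := by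
    intro v
    induction v with
    | zero => exact fun _ s h hi => ⟨s, (Runs.loop_of_eq hi).mono (by omega), h⟩
    | succ v ih =>
      intro hv s h hi
      obtain ⟨s₁, hr₁, hI₁, hi₁⟩ := hp v (by omega) s h hi
      obtain ⟨s₂, hr₂, hI₂⟩ := ih (by omega) s₁ hI₁ hi₁
      have hsub := Runs.sub i i 2 s
      rw [hi, h2 _ _ h, Nat.add_sub_cancel] at hsub
      exact ⟨s₂, (Runs.loop_of_ne (by omega) (hsub.seq hr₁) hr₂).mono (by linarith), hI₂⟩
  obtain ⟨s', hr, hI⟩ := key m le_rfl _ h0 (by simp [Store.setReg])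
  have hadd := Runs.add i c 3 s
  rw [hc, hs3, Nat.add_zero] at hadd
  exact ⟨s', (hadd.seq hr).mono (by omega), hI⟩

/-! ### Forward chaining of Horn clauses -/

/-- A Horn clause on natural numbers: a set of premises, and a conclusion. -/
abbrev Clause : Type := Set ℕ × ℕ

/-- The set `A` satisfies the clauses `H`. -/
def Models (A : Set ℕ) (H : Set Clause) : Prop :=
  ∀ c ∈ H, c.1 ⊆ A → c.2 ∈ A

/-- The set `A'` arises from `A` by a round of forward chaining that uses clauses of `H` only, and
each of them at least once. -/
structure Round (H : Set Clause) (A A' : Set ℕ) : Prop where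
  subset : A ⊆ A'
  sound : ∀ C, Models C H → A ⊆ C → A' ⊆ C
  fired : ∀ c ∈ H, c.1 ⊆ A → c.2 ∈ A'

theorem models_union {A : Set ℕ} {H H' : Set Clause} :
    Models A (H ∪ H') ↔ Models A H ∧ Models A H' := by
  simp only [Models, Set.mem_union, or_imp, forall_and]

theorem models_fact {A : Set ℕ} {w : ℕ} : Models A {(∅, w)} ↔ w ∈ A := by
  simp [Models]

/-- The clauses `H` with the additional premise `w`. -/
def withPremise (w : ℕ) (H : Set Clause) : Set Clause :=
  (fun c => (insert w c.1, c.2)) '' H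

theorem models_withPremise {A : Set ℕ} {w : ℕ} {H : Set Clause} :
    Models A (withPremise w H) ↔ (w ∈ A → Models A H) := by
  simp only [Models, withPremise, Set.forall_mem_image, Set.insert_subset_iff]
  tauto

theorem models_iUnion {ι : Sort*} {A : Set ℕ} {H : ι → Set Clause} :
    Models A (⋃ i, H i) ↔ ∀ i, Models A (H i) := by
  simp only [Models, Set.mem_iUnion]
  exact ⟨fun h i c hc => h c ⟨i, hc⟩, fun h c ⟨i, hc⟩ => h i c hc⟩

namespace Round

theorem refl (A : Set ℕ) : Round ∅ A A :=
  ⟨subset_rfl, fun _ _ h => h, fun _ h => absurd h (Set.notMem_empty _)⟩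

/-- Marks made early in a round may trigger clauses later in it. `Round` therefore only bounds the
result, from below by the immediate consequences and from above by every model, and such bounds
compose. -/
theorem trans {H H' : Set Clause} {A A' A'' : Set ℕ} (h : Round H A A') (h' : Round H' A' A'') :
    Round (H ∪ H') A A'' := by
  refine ⟨h.subset.trans h'.subset, fun C hC hA => ?_, ?_⟩
  · rw [models_union] at hC
    exact h'.sound C hC.2 (h.sound C hC.1 hA)
  · rintro c (hc | hc) hcA
    · exact h'.subset (h.fired c hc hcA)
    · exact h'.fired c hc (hcA.trans h.subset)

theorem fact (A : Set ℕ) (w : ℕ) : Round {(∅, w)} A (insert w A) :=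
  ⟨Set.subset_insert _ _, fun _ hC hA => Set.insert_subset (models_fact.1 hC) hA,
    fun c hc _ => by rw [Set.mem_singleton_iff.1 hc]; exact Set.mem_insert _ _⟩

theorem withPremise_of_mem {H : Set Clause} {A A' : Set ℕ} {w : ℕ} (h : Round H A A')
    (hw : w ∈ A) : Round (withPremise w H) A A' := by
  refine ⟨h.subset, fun C hC hA => h.sound C (models_withPremise.1 hC (hA hw)) hA, ?_⟩
  rintro _ ⟨c, hc, rfl⟩ hcA
  exact h.fired c hc ((Set.subset_insert _ _).trans hcA)

theorem withPremise_of_notMem {H : Set Clause} {A : Set ℕ} {w : ℕ} (hw : w ∉ A) :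
    Round (withPremise w H) A A := by
  refine ⟨subset_rfl, fun C _ hA => hA, ?_⟩
  rintro _ ⟨c, -, rfl⟩ hcA
  exact absurd (hcA (Set.mem_insert _ _)) hw

theorem models_of_eq {H : Set Clause} {A : Set ℕ} (h : Round H A A) : Models A H :=
  h.fired

theorem eq_of_models {H : Set Clause} {A A' : Set ℕ} (h : Round H A A') (hA : Models A H) :
    A' = A :=
  (h.sound A hA subset_rfl).antisymm h.subset

end Round

/-! ### Programs that perform rounds of forward chaining -/

/-- The numbers that are marked in the array `arr 4`. -/
def Store.marked (s : Store) : Set ℕ := {a | s.arr 4 a ≠ 0}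

/-- The program `p` preserves `I` and performs a round of forward chaining in time `T`. -/
def Pass (p : Prog) (I : Store → Prop) (T : ℕ) (H : Set Clause) : Prop :=
  ∀ s, I s → ∃ s', Runs p s s' T ∧ I s' ∧ Round H s.marked s'.marked

/-- `I` depends neither on the array `arr 4` nor on the auxiliary variables, from `reg 20` on. -/
def Stable (I : Store → Prop) : Prop :=
  ∀ s s' : Store, (∀ r < 20, s'.reg r = s.reg r) → (∀ a, a ≠ 4 → s'.arr a = s.arr a) → I s → I s'

/-- No effect on the variables below `reg 20` and on the arrays. -/
def skip : Prog := .const 22 0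

/-- Marks the number `arr 3 (reg a) + reg b`. -/
def mark (a b : ℕ) : Prog :=
  .seq (.load 20 3 a) (.seq (.add 20 20 b) (.store 4 20 2))

/-- Executes `p` if the number `arr 3 (reg a) + reg b` is marked. -/
def test (a b : ℕ) (p : Prog) : Prog :=
  .seq (.load 20 3 a) (.seq (.add 20 20 b) (.seq (.load 21 4 20) (.ite 21 p skip)))

namespace Pass

variable {I : Store → Prop} {p q : Prog} {T T' : ℕ} {H H' : Set Clause}

theorem seq (hp : Pass p I T H) (hq : Pass q I T' H') :
    Pass (.seq p q) I (T' + T + 1) (H ∪ H') := by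
  intro s hs
  obtain ⟨s₁, h₁, hI₁, hR₁⟩ := hp s hs
  obtain ⟨s₂, h₂, hI₂, hR₂⟩ := hq s₁ hI₁
  exact ⟨s₂, h₁.seq h₂, hI₂, hR₁.trans hR₂⟩

theorem skip (hI : Stable I) : Pass skip I 1 ∅ := fun s hs =>
  ⟨_, Runs.const 22 0 s,
    hI s _ (fun r hr => Function.update_of_ne (by omega) _ _) (fun _ _ => rfl) hs,
    Round.refl _⟩

theorem mark (hI : Stable I) {a b w : ℕ} (hb : b < 20) (h2 : ∀ s, I s → s.reg 2 = 1)
    (hw : ∀ s, I s → s.arr 3 (s.reg a) + s.reg b = w) :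
    Pass (mark a b) I 5 {(∅, w)} := by
  intro s hs
  refine ⟨_, (Runs.load 20 3 a s).seq ((Runs.add 20 20 b _).seq (Runs.store 4 20 2 _)),
    hI s _ (fun r hr => ?_) (fun c hc => ?_) hs, ?_⟩
  · have : r ≠ 20 := by omega
    simp [Store.setReg, Store.setArr, this]
  · simp [Store.setReg, Store.setArr, hc]
  · convert Round.fact s.marked w using 1
    have hb' : b ≠ 20 := by omega
    ext x
    have e₁ := hw s hs
    have e₂ := h2 s hs
    by_cases hx : x = w <;>
      simp [Store.setReg, Store.setArr, Store.marked, Function.update_apply, hb', e₁, e₂, hx]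

/-- If `w` is unmarked at the time of the test, no clause with premise `w` has to fire; if it is
marked, the extra premise costs nothing. -/
theorem test (hI : Stable I) {a b w : ℕ} (hb : b < 20)
    (hw : ∀ s, I s → s.arr 3 (s.reg a) + s.reg b = w) (hp : Pass p I T H) :
    Pass (test a b p) I (T + 8) (withPremise w H) := by
  intro s hs
  have hb' : b ≠ 20 := by omega
  have e₁ := hw s hs
  let s₁ := (s.setReg 20 (s.arr 3 (s.reg a))).setReg 20 w
  let s₂ := s₁.setReg 21 (s.arr 4 w)
  have hadd : Runs (.add 20 20 b) (s.setReg 20 (s.arr 3 (s.reg a))) s₁ 1 := by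
    have := Runs.add 20 20 b (s.setReg 20 (s.arr 3 (s.reg a)))
    simpa [Store.setReg, hb', e₁, s₁] using this
  have hload : Runs (.load 21 4 20) s₁ s₂ 1 := by
    have := Runs.load 21 4 20 s₁
    simpa [Store.setReg, s₁, s₂] using this
  have hI₂ : I s₂ := by
    refine hI s _ (fun r hr => ?_) (fun c hc => rfl) hs
    have h1 : r ≠ 20 := by omega
    have h2 : r ≠ 21 := by omega
    simp [s₂, s₁, Store.setReg, h1, h2]
  have hm : s₂.marked = s.marked := rfl
  have h21 : s₂.reg 21 = s.arr 4 w := by simp [s₂, Store.setReg]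
  by_cases hwm : w ∈ s.marked
  · obtain ⟨s₃, hr, hI₃, hR⟩ := hp s₂ hI₂
    refine ⟨s₃, ((Runs.load 20 3 a s).seq (hadd.seq (hload.seq
      (Runs.ite_of_ne (h21.trans_ne hwm) hr)))).mono (by omega), hI₃, ?_⟩
    rw [hm] at hR
    exact hR.withPremise_of_mem hwm
  · obtain ⟨s₃, hr, hI₃, hR⟩ := Pass.skip hI s₂ hI₂
    refine ⟨s₃, ((Runs.load 20 3 a s).seq (hadd.seq (hload.seq
      (Runs.ite_of_eq (h21.trans (not_not.1 hwm)) hr)))).mono (by omega), hI₃, ?_⟩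
    have : s₃.marked = s.marked := by
      rw [← hm]; exact hR.eq_of_models fun c hc => absurd hc (Set.notMem_empty c)
    rw [this]
    exact Round.withPremise_of_notMem hwm

/-- The condition `φ` does not depend on the marks: it selects which clauses exist, instead of being
a premise. -/
theorem ite_skip (hI : Stable I) {x : ℕ} {φ : Prop} (hx : ∀ s, I s → (s.reg x ≠ 0 ↔ φ))
    (hp : φ → Pass p I T H) : Pass (.ite x p RAM.skip) I (T + 2) (⋃ _ : φ, H) := by
  intro s hs
  by_cases hφ : φ
  · obtain ⟨s', hr, hI', hR⟩ := hp hφ s hs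
    refine ⟨s', (Runs.ite_of_ne ((hx s hs).2 hφ) hr).mono (by omega), hI', ?_⟩
    simpa [hφ] using hR
  · obtain ⟨s', hr, hI', hR⟩ := Pass.skip hI s hs
    refine ⟨s', (Runs.ite_of_eq (not_not.1 (mt (hx s hs).1 hφ)) hr).mono (by omega), hI', ?_⟩
    simpa [hφ] using hR

theorem forDown {i c m : ℕ} {H : ℕ → Set Clause}
    (hI : ∀ s, I s → s.reg 2 = 1 ∧ s.reg 3 = 0 ∧ s.reg c = m)
    (hi : ∀ s v, I s → I (s.setReg i v))
    (hp : ∀ v < m, Pass p (fun s => I s ∧ s.reg i = v) T (H v)) :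
    Pass (forDown i c p) I (m * (T + 3) + 3) (⋃ v : Fin m, H v) := by
  intro s hs
  have key := runs_forDown (T := T) (p := p) (s := s) (i := i)
    (fun v s' => I s' ∧ Round (⋃ u : {u : Fin m // v ≤ u.val}, H u.1) s.marked s'.marked)
    (hI s hs).2.1 (hI s hs).2.2 ⟨hi s m hs, ?_⟩ (fun v s' h => (hI s' h.1).1) ?_
  · obtain ⟨s', hr, hI', hR⟩ := key
    refine ⟨s', hr, hI', ?_⟩
    convert hR using 1
    ext c
    simp
  · have : IsEmpty {u : Fin m // m ≤ u.val} := ⟨fun u => absurd u.1.isLt (by have := u.2; omega)⟩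
    rw [Set.iUnion_of_empty]
    exact Round.refl _
  · rintro v hv s₁ ⟨hI₁, hR₁⟩ -
    obtain ⟨s₂, hr₂, ⟨hI₂, hi₂⟩, hR₂⟩ := hp v hv _ ⟨hi s₁ v hI₁, by simp [Store.setReg]⟩
    refine ⟨s₂, hr₂, ⟨hI₂, ?_⟩, hi₂⟩
    convert hR₁.trans hR₂ using 1
    ext c
    simp only [Set.mem_iUnion, Set.mem_union, Subtype.exists]
    constructor
    · rintro ⟨u, hu, hc⟩
      rcases hu.eq_or_lt with rfl | h
      · exact .inr hc
      · exact .inl ⟨u, h, hc⟩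
    · rintro (⟨u, hu, hc⟩ | hc)
      · exact ⟨u, by omega, hc⟩
      · exact ⟨⟨v, hv⟩, le_rfl, hc⟩

/-- Sufficiently many passes compute the least set that satisfies the clauses. -/
theorem saturate {i c m B : ℕ} (hI : ∀ s, I s → s.reg 2 = 1 ∧ s.reg 3 = 0 ∧ s.reg c = m)
    (hi : ∀ s v, I s → I (s.setReg i v))
    (hp : ∀ v, Pass p (fun s => I s ∧ s.reg i = v) T H)
    (hB : Models {a | a < B} H) (hm : B < m) {s : Store} (hs : I s) (h0 : s.marked = ∅) :
    ∃ s', Runs (RAM.forDown i c p) s s' (m * (T + 3) + 3) ∧ I s' ∧ Models s'.marked H ∧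
      ∀ C, Models C H → s'.marked ⊆ C := by
  have hfin : ∀ {A : Set ℕ}, A ⊆ {a | a < B} → A.Finite := fun h => (Set.finite_lt_nat B).subset h
  have hcard : ∀ {A : Set ℕ}, A ⊆ {a | a < B} → A.ncard ≤ B := fun h => by
    refine (Set.ncard_le_ncard h (Set.finite_lt_nat B)).trans ?_
    have e : {a | a < B} = (Finset.range B : Set ℕ) := by ext; simp
    rw [e, Set.ncard_coe_finset, Finset.card_range]
  -- With `v` passes to go, either a model has been reached or each of the `m - v` passes made has
  -- added a mark. At `v = 0` the second case would give `m` marks, more than the `B` available.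
  have key := runs_forDown (T := T) (p := p) (s := s) (i := i)
    (fun v s' => I s' ∧ (∀ C, Models C H → s'.marked ⊆ C) ∧
      (Models s'.marked H ∨ m ≤ s'.marked.ncard + v))
    (hI s hs).2.1 (hI s hs).2.2
    ⟨hi s m hs, fun C _ => by change s.marked ⊆ C; simp [h0], .inr (by omega)⟩
    (fun v s' h => (hI s' h.1).1) ?_
  · obtain ⟨s', hr, hI', hS, hM⟩ := key
    refine ⟨s', hr, hI', hM.resolve_right fun h => ?_, hS⟩
    have := hcard (hS _ hB)
    omega
  · rintro v - s₁ ⟨hI₁, hS₁, hM₁⟩ -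
    obtain ⟨s₂, hr₂, ⟨hI₂, hi₂⟩, hR⟩ := hp v _ ⟨hi s₁ v hI₁, by simp [Store.setReg]⟩
    change Round H s₁.marked s₂.marked at hR
    have hS₂ : ∀ C, Models C H → s₂.marked ⊆ C := fun C hC => hR.sound C hC (hS₁ C hC)
    refine ⟨s₂, hr₂, ⟨hI₂, hS₂, ?_⟩, hi₂⟩
    by_cases he : Models s₁.marked H
    · rw [hR.eq_of_models he]; exact .inl he
    · right
      have hlt : s₁.marked.ncard < s₂.marked.ncard := by
        refine Set.ncard_lt_ncard (hR.subset.ssubset_of_ne fun e => he ?_) (hfin (hS₂ _ hB))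
        rw [← e] at hR
        exact hR.models_of_eq
      have := hM₁.resolve_left he
      omega

end Pass

end RAM

/-! ### The clauses of a profile on the machine -/

namespace DirectedProfile

open RAM

variable {n : ℕ}

/-- The number that represents the assertion that `x` is weakly on the left of `y`. -/
def address {n : ℕ} (x y : Fin (n + 2)) : ℕ := x.val * (n + 2) + y.val

/-- The number that represents a contradiction. -/
def falsum (n : ℕ) : ℕ := (n + 2) * (n + 2)

theorem address_lt_falsum (x y : Fin (n + 2)) : address x y < falsum n := by
  have h := Nat.mul_le_mul_right (n + 2) (show x.val + 1 ≤ n + 2 by omega)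
  have := y.isLt
  unfold address falsum
  linarith

theorem address_inj {x y x' y' : Fin (n + 2)} (h : address x y = address x' y') :
    x = x' ∧ y = y' := by
  unfold address at h
  have h₁ := congrArg (· / (n + 2)) h
  have h₂ := congrArg (· % (n + 2)) h
  simp only [Nat.add_comm _ y.val, Nat.add_comm _ y'.val, Nat.add_mul_div_right _ _
    (Nat.succ_pos (n + 1)), Nat.div_eq_of_lt y.isLt, Nat.div_eq_of_lt y'.isLt, Nat.zero_add,
    Nat.add_mul_mod_self_right, Nat.mod_eq_of_lt y.isLt, Nat.mod_eq_of_lt y'.isLt] at h₁ h₂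
  exact ⟨Fin.ext h₁, Fin.ext h₂⟩

/-- The instances of the clauses that the body of the main loop applies, on the set `A` of the
numbers of the asserted precedences. -/
def RulesAt (F : DirectedProfile n) (t : Fin (n + 1)) (x y z : Fin (n + 2)) (A : Set ℕ) : Prop :=
  address 0 x ∈ A ∧ address x (Fin.last (n + 1)) ∈ A ∧ address x x ∈ A ∧
  address (F.src t) (F.lo t) ∈ A ∧ address (F.lo t) (F.tgt t) ∈ A ∧
  address (F.src t) (F.hi t) ∈ A ∧ address (F.hi t) (F.tgt t) ∈ A ∧
  (address x y ∈ A → address y z ∈ A → address x z ∈ A) ∧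
  (z ∉ Set.Icc (F.lo t) (F.hi t) → (address (F.src t) z ∈ A → address (F.tgt t) z ∈ A) ∧
    (address z (F.tgt t) ∈ A → address z (F.src t) ∈ A)) ∧
  (x ≠ y → address x y ∈ A → address y x ∈ A → falsum n ∈ A)

/-- The index of the pair that is treated together with the element `x`. -/
def pairIndex {n : ℕ} (x : Fin (n + 2)) : Fin (n + 1) := ⟨x.val - 1, by omega⟩

/-- The pair `t` is treated at `x = t+1`, so every `t` occurs as `x` varies, and three nested loops
suffice instead of four. -/
theorem forall_rulesAt_iff {F : DirectedProfile n} {A : Set ℕ} :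
    (∀ x y z, F.RulesAt (pairIndex x) x y z A) ↔
      F.IsClosed (fun x y => address x y ∈ A) ∧
        ∀ x y : Fin (n + 2), x ≠ y → address x y ∈ A → address y x ∈ A → falsum n ∈ A := by
  constructor
  · intro h
    have ht : ∀ t : Fin (n + 1), pairIndex t.succ = t := fun t => Fin.ext (by simp [pairIndex])
    have h' : ∀ t x y z, x = t.succ → F.RulesAt t x y z A := fun t x y z e => by
      have := h x y z
      rwa [e, ht, ← e] at this
    exact ⟨⟨fun x => (h x x x).2.2.1, fun x => (h x x x).1, fun x => (h x x x).2.1,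
      fun t => (h' t _ 0 0 rfl).2.2.2.1, fun t => (h' t _ 0 0 rfl).2.2.2.2.1,
      fun t => (h' t _ 0 0 rfl).2.2.2.2.2.1, fun t => (h' t _ 0 0 rfl).2.2.2.2.2.2.1,
      fun x y z => (h x y z).2.2.2.2.2.2.2.1,
      fun t z hz => ((h' t _ 0 z rfl).2.2.2.2.2.2.2.2.1 hz).1,
      fun t z hz => ((h' t _ 0 z rfl).2.2.2.2.2.2.2.2.1 hz).2⟩,
      fun x y => (h x y x).2.2.2.2.2.2.2.2.2⟩
  · rintro ⟨h, hb⟩ x y z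
    exact ⟨h.zero x, h.last x, h.refl x, h.src_lo _, h.lo_tgt _, h.src_hi _, h.hi_tgt _,
      h.trans x y z, fun hz => ⟨h.right _ z hz, h.left _ z hz⟩, hb x y⟩

/-- The constants and tables on which the main loop relies. -/
structure Tables (F : DirectedProfile n) (s : Store) : Prop where
  size : s.reg 1 = n + 2
  one : s.reg 2 = 1
  zero : s.reg 3 = 0
  last : s.reg 4 = n + 1
  rounds : s.reg 17 = (n + 3) * (n + 2)
  input : ∀ a < 3, s.arr a = F.encode.arr a
  row : ∀ k ≤ n + 2, s.arr 3 k = k * (n + 2)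

theorem Tables.congr {F : DirectedProfile n} {s s' : Store} (h : F.Tables s)
    (hr : ∀ r ∈ [1, 2, 3, 4, 17], s'.reg r = s.reg r) (ha : ∀ a, a ≠ 4 → s'.arr a = s.arr a) :
    F.Tables s' where
  size := (hr 1 (by simp)).trans h.size
  one := (hr 2 (by simp)).trans h.one
  zero := (hr 3 (by simp)).trans h.zero
  last := (hr 4 (by simp)).trans h.last
  rounds := (hr 17 (by simp)).trans h.rounds
  input a h' := (ha a (by omega)).trans (h.input a h')
  row k h' := (congrFun (ha 3 (by omega)) k).trans (h.row k h')

theorem Tables.setReg {F : DirectedProfile n} {s : Store} (h : F.Tables s) {i v : ℕ}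
    (hi : i ∉ [1, 2, 3, 4, 17]) : F.Tables (s.setReg i v) :=
  h.congr (fun r hr => Function.update_of_ne (fun e : r = i => hi (e ▸ hr)) _ _) fun _ _ => rfl

/-- The state of the machine while it applies the clauses at `x`, `y`, `z`. -/
structure BodyState (F : DirectedProfile n) (v : ℕ) (t : Fin (n + 1)) (x y z : Fin (n + 2))
    (s : Store) : Prop where
  tables : F.Tables s
  reg5 : s.reg 5 = v
  reg6 : s.reg 6 = x
  reg7 : s.reg 7 = y
  reg8 : s.reg 8 = z
  reg11 : s.reg 11 = F.lo t
  reg12 : s.reg 12 = F.hi t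
  reg13 : s.reg 13 = F.src t
  reg14 : s.reg 14 = F.tgt t
  reg15 : s.reg 15 ≠ 0 ↔ z ∉ Set.Icc (F.lo t) (F.hi t)
  reg16 : s.reg 16 ≠ 0 ↔ x ≠ y

theorem stable_bodyState (F : DirectedProfile n) (v : ℕ) (t : Fin (n + 1)) (x y z : Fin (n + 2)) :
    Stable (F.BodyState v t x y z) := fun s s' hr ha h =>
  { tables := h.tables.congr (fun r hr' => hr r (by simp at hr'; omega)) ha
    reg5 := (hr _ (by omega)).trans h.reg5
    reg6 := (hr _ (by omega)).trans h.reg6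
    reg7 := (hr _ (by omega)).trans h.reg7
    reg8 := (hr _ (by omega)).trans h.reg8
    reg11 := (hr _ (by omega)).trans h.reg11
    reg12 := (hr _ (by omega)).trans h.reg12
    reg13 := (hr _ (by omega)).trans h.reg13
    reg14 := (hr _ (by omega)).trans h.reg14
    reg15 := by rw [hr _ (by omega)]; exact h.reg15
    reg16 := by rw [hr _ (by omega)]; exact h.reg16 }

/-- Applies the clauses. -/
def rulesProg : Prog :=
  .seq (mark 3 6) <| .seq (mark 6 4) <| .seq (mark 6 6) <|
  .seq (mark 13 11) <| .seq (mark 11 14) <| .seq (mark 13 12) <| .seq (mark 12 14) <|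
  .seq (test 6 7 (test 7 8 (mark 6 8))) <|
  .seq (.ite 15 (.seq (test 13 8 (mark 14 8)) (test 8 14 (mark 8 13))) RAM.skip)
    (.ite 16 (test 6 7 (test 7 6 (mark 1 3))) RAM.skip)

theorem exists_pass_rulesProg (F : DirectedProfile n) (t : Fin (n + 1))
    (x y z : Fin (n + 2)) :
    ∃ H, (∀ v, Pass rulesProg (F.BodyState v t x y z) 117 H) ∧
      ∀ A, Models A H ↔ F.RulesAt t x y z A := by
  -- The set of clauses is read off from the program by unification; being chosen before `v`, it is
  -- the same in every round.
  refine ⟨_, fun v => by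
    have hI := F.stable_bodyState v t x y z
    have h2 : ∀ s, F.BodyState v t x y z s → s.reg 2 = 1 := fun s hs => hs.tables.one
    have had : ∀ {a b : ℕ} {i j : Fin (n + 2)},
        (∀ s, F.BodyState v t x y z s → s.reg a = i) →
        (∀ s, F.BodyState v t x y z s → s.reg b = j) →
        ∀ s, F.BodyState v t x y z s → s.arr 3 (s.reg a) + s.reg b = address i j :=
      fun ha hb s hs => by
        rw [ha s hs, hb s hs, hs.tables.row _ (by omega)]; rfl
    have r3 : ∀ s, F.BodyState v t x y z s → s.reg 3 = (0 : Fin (n + 2)) :=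
      fun s hs => hs.tables.zero
    have r4 : ∀ s, F.BodyState v t x y z s → s.reg 4 = Fin.last (n + 1) :=
      fun s hs => hs.tables.last
    have r6 : ∀ s, F.BodyState v t x y z s → s.reg 6 = x := fun s hs => hs.reg6
    have r7 : ∀ s, F.BodyState v t x y z s → s.reg 7 = y := fun s hs => hs.reg7
    have r8 : ∀ s, F.BodyState v t x y z s → s.reg 8 = z := fun s hs => hs.reg8
    have r11 : ∀ s, F.BodyState v t x y z s → s.reg 11 = F.lo t := fun s hs => hs.reg11
    have r12 : ∀ s, F.BodyState v t x y z s → s.reg 12 = F.hi t := fun s hs => hs.reg12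
    have r13 : ∀ s, F.BodyState v t x y z s → s.reg 13 = F.src t := fun s hs => hs.reg13
    have r14 : ∀ s, F.BodyState v t x y z s → s.reg 14 = F.tgt t := fun s hs => hs.reg14
    -- Row `n+2` of the table, beyond all elements, gives the number of the contradiction.
    have hbot : ∀ s, F.BodyState v t x y z s → s.arr 3 (s.reg 1) + s.reg 3 = falsum n :=
      fun s hs => by rw [hs.tables.size, hs.tables.zero, hs.tables.row _ le_rfl]; rfl
    exact (Pass.mark hI (by omega) h2 (had r3 r6)).seq <|
      (Pass.mark hI (by omega) h2 (had r6 r4)).seq <|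
      (Pass.mark hI (by omega) h2 (had r6 r6)).seq <|
      (Pass.mark hI (by omega) h2 (had r13 r11)).seq <|
      (Pass.mark hI (by omega) h2 (had r11 r14)).seq <|
      (Pass.mark hI (by omega) h2 (had r13 r12)).seq <|
      (Pass.mark hI (by omega) h2 (had r12 r14)).seq <|
      (Pass.test hI (by omega) (had r6 r7) <| Pass.test hI (by omega) (had r7 r8) <|
        Pass.mark hI (by omega) h2 (had r6 r8)).seq <|
      (Pass.ite_skip hI (fun s hs => hs.reg15) fun _ =>
        (Pass.test hI (by omega) (had r13 r8) <| Pass.mark hI (by omega) h2 (had r14 r8)).seq <|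
        (Pass.test hI (by omega) (had r8 r14) <| Pass.mark hI (by omega) h2 (had r8 r13))).seq <|
      (Pass.ite_skip hI (fun s hs => hs.reg16) fun _ =>
        Pass.test hI (by omega) (had r6 r7) <| Pass.test hI (by omega) (had r7 r6) <|
        Pass.mark hI (by omega) h2 hbot),
    fun A => ?_⟩
  simp only [models_union, models_fact, models_withPremise, models_iUnion, RulesAt]

/-- Loads the constraint on the pair that is treated together with `reg 6`, and tests if `reg 8` is
outside of its interval and if `reg 6` and `reg 7` are distinct. -/
def prepareProg : Prog :=
  .seq (.sub 9 6 2) <| .seq (.add 10 9 2) <|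
  .seq (.load 11 0 9) <| .seq (.load 12 1 9) <| .seq (.load 20 2 9) <|
  .seq (.ite 20 (.seq (.add 13 9 3) (.add 14 10 3)) (.seq (.add 13 10 3) (.add 14 9 3))) <|
  .seq (.sub 15 11 8) <| .seq (.sub 20 8 12) <| .seq (.add 15 15 20) <|
  .seq (.sub 16 6 7) <| .seq (.sub 20 7 6) (.add 16 16 20)

theorem runs_add_of_eq {x y z v : ℕ} {s : Store} (hv : s.reg y + s.reg z = v) :
    Runs (.add x y z) s (s.setReg x v) 1 :=
  hv ▸ Runs.add x y z s

theorem runs_sub_of_eq {x y z v : ℕ} {s : Store} (hv : s.reg y - s.reg z = v) :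
    Runs (.sub x y z) s (s.setReg x v) 1 :=
  hv ▸ Runs.sub x y z s

theorem runs_load_of_eq {x a i v : ℕ} {s : Store} (hv : s.arr a (s.reg i) = v) :
    Runs (.load x a i) s (s.setReg x v) 1 :=
  hv ▸ Runs.load x a i s

theorem runs_orient (F : DirectedProfile n) (t : Fin (n + 1)) (s : Store) (h3 : s.reg 3 = 0)
    (h9 : s.reg 9 = t) (h10 : s.reg 10 = t.val + 1) (h20 : s.reg 20 = (F.fwd t).toNat) :
    Runs (.ite 20 (.seq (.add 13 9 3) (.add 14 10 3)) (.seq (.add 13 10 3) (.add 14 9 3))) s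
      ((s.setReg 13 (F.src t)).setReg 14 (F.tgt t)) 4 := by
  cases hF : F.fwd t
  · refine Runs.ite_of_eq (by simp [h20, hF])
      ((runs_add_of_eq ?_).seq (runs_add_of_eq ?_)) <;>
    simp [Store.setReg, src, tgt, *]
  · refine Runs.ite_of_ne (by simp [h20, hF])
      ((runs_add_of_eq ?_).seq (runs_add_of_eq ?_)) <;>
    simp [Store.setReg, src, tgt, *]

theorem runs_prepareProg (F : DirectedProfile n) (v : ℕ) (x y z : Fin (n + 2)) (s : Store)
    (hs : F.Tables s) (h5 : s.reg 5 = v) (h6 : s.reg 6 = x) (h7 : s.reg 7 = y)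
    (h8 : s.reg 8 = z) :
    ∃ s', Runs prepareProg s s' 26 ∧ F.BodyState v (pairIndex x) x y z s' ∧
      s'.marked = s.marked := by
  obtain ⟨t, ht⟩ : ∃ t, t = pairIndex x := ⟨_, rfl⟩
  rw [← ht]
  have htx : x.val - 1 = t.val := by rw [ht]; rfl
  have e0 : F.encode.arr 0 t.val = F.lo t := dif_pos t.isLt
  have e1 : F.encode.arr 1 t.val = F.hi t := dif_pos t.isLt
  have e2 : F.encode.arr 2 t.val = (F.fwd t).toNat := dif_pos t.isLt
  refine ⟨_, (runs_sub_of_eq (v := t.val) ?_).seq <| (runs_add_of_eq (v := t.val + 1) ?_).seq <|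
    (runs_load_of_eq (v := (F.lo t).val) ?_).seq <|
    (runs_load_of_eq (v := (F.hi t).val) ?_).seq <|
    (runs_load_of_eq (v := (F.fwd t).toNat) ?_).seq <|
    (F.runs_orient t _ ?_ ?_ ?_ ?_).seq <|
    (runs_sub_of_eq (v := (F.lo t).val - z.val) ?_).seq <|
    (runs_sub_of_eq (v := z.val - (F.hi t).val) ?_).seq <|
    (runs_add_of_eq (v := (F.lo t).val - z.val + (z.val - (F.hi t).val)) ?_).seq <|
    (runs_sub_of_eq (v := x.val - y.val) ?_).seq <|
    (runs_sub_of_eq (v := y.val - x.val) ?_).seq <|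
    (runs_add_of_eq (v := x.val - y.val + (y.val - x.val)) ?_),
    ⟨?_, ?_, ?_, ?_, ?_, ?_, ?_, ?_, ?_, ?_, ?_⟩, rfl⟩
  case refine_16 =>
    refine hs.congr (fun r hr => ?_) fun _ _ => rfl
    simp only [List.mem_cons, List.not_mem_nil, or_false] at hr
    rcases hr with rfl | rfl | rfl | rfl | rfl <;> simp [Store.setReg]
  -- With truncated subtraction, `(lo - z) + (z - hi)` is nonzero exactly if `z` is outside the
  -- interval; the sum of the two differences tests `x ≠ y` likewise.
  case refine_25 =>
    rw [Set.mem_Icc, Fin.le_def, Fin.le_def]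
    simp only [Store.setReg, Function.update_self, ne_eq, Nat.reduceEqDiff, not_false_eq_true,
      Function.update_of_ne]
    omega
  case refine_26 =>
    simp [Store.setReg, Fin.ext_iff]
    omega
  all_goals
    simp [Store.setReg, h5, h6, h7, h8, hs.one, hs.zero, hs.input, htx, e0, e1, e2]

end DirectedProfile

/-! ### The complete program and its correctness -/

namespace DirectedProfile

open RAM

variable {n : ℕ}

/-- The loops over `x`, `y`, `z`. -/
def sweepProg : Prog :=
  forDown 6 1 (forDown 7 1 (forDown 8 1 (.seq prepareProg rulesProg)))

theorem exists_pass_sweepProg (F : DirectedProfile n) :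
    ∃ H, (∀ v, Pass sweepProg (fun s => F.Tables s ∧ s.reg 5 = v)
      ((n + 2) * ((n + 2) * ((n + 2) * 147 + 6) + 6) + 3) H) ∧
      ∀ A, Models A H ↔ ∀ x y z, F.RulesAt (pairIndex x) x y z A := by
  choose H hH hM using fun x y z => F.exists_pass_rulesProg (pairIndex x) x y z
  have body : ∀ v, ∀ x y z : Fin (n + 2), Pass (.seq prepareProg rulesProg)
      (fun s => (((F.Tables s ∧ s.reg 5 = v) ∧ s.reg 6 = x) ∧ s.reg 7 = y) ∧ s.reg 8 = z)
      144 (H x y z) := by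
    rintro v x y z s ⟨⟨⟨⟨hs, h5⟩, h6⟩, h7⟩, h8⟩
    obtain ⟨s₁, hr₁, hI₁, hm₁⟩ := F.runs_prepareProg v x y z s hs h5 h6 h7 h8
    obtain ⟨s₂, hr₂, hI₂, hR₂⟩ := hH x y z v s₁ hI₁
    refine ⟨s₂, hr₁.seq hr₂,
      ⟨⟨⟨⟨hI₂.tables, hI₂.reg5⟩, hI₂.reg6⟩, hI₂.reg7⟩, hI₂.reg8⟩, ?_⟩
    rwa [← hm₁]
  -- The loop rule takes families indexed by all natural numbers; the empty value outside the range
  -- is never used.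
  let H' : ℕ → ℕ → ℕ → Set Clause := fun x y z =>
    if h : x < n + 2 ∧ y < n + 2 ∧ z < n + 2 then H ⟨x, h.1⟩ ⟨y, h.2.1⟩ ⟨z, h.2.2⟩ else ∅
  have hH' : ∀ x y z : Fin (n + 2), H' x y z = H x y z := fun x y z =>
    dif_pos ⟨x.isLt, y.isLt, z.isLt⟩
  refine ⟨_, fun v => Pass.forDown (m := n + 2) (H := fun x => ⋃ y : Fin (n + 2), ⋃ z : Fin (n + 2), H' x y z)
    (fun s hs => ⟨hs.1.one, hs.1.zero, hs.1.size⟩)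
    (fun s i hs => ⟨hs.1.setReg (by simp), by simpa [Store.setReg] using hs.2⟩) fun x hx =>
    Pass.forDown (m := n + 2) (H := fun y => ⋃ z : Fin (n + 2), H' x y z)
    (fun s hs => ⟨hs.1.1.one, hs.1.1.zero, hs.1.1.size⟩)
    (fun s i hs => ⟨⟨hs.1.1.setReg (by simp), by simpa [Store.setReg] using hs.1.2⟩,
      by simpa [Store.setReg] using hs.2⟩) fun y hy =>
    Pass.forDown (m := n + 2) (H := fun z => H' x y z)
    (fun s hs => ⟨hs.1.1.1.one, hs.1.1.1.zero, hs.1.1.1.size⟩)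
    (fun s i hs => ⟨⟨⟨hs.1.1.1.setReg (by simp), by simpa [Store.setReg] using hs.1.1.2⟩,
      by simpa [Store.setReg] using hs.1.2⟩, by simpa [Store.setReg] using hs.2⟩) fun z hz => ?_,
    fun A => ?_⟩
  · have := hH' ⟨x, hx⟩ ⟨y, hy⟩ ⟨z, hz⟩
    dsimp only at this
    rw [this]
    exact body v ⟨x, hx⟩ ⟨y, hy⟩ ⟨z, hz⟩
  · simp only [models_iUnion, hH', hM]

/-- Sets up the constants and the table of the multiples of `n + 2`. -/
def tablesProg : Prog :=
  .seq (.const 2 1) <| .seq (.add 4 0 2) <| .seq (.add 1 4 2) <| .seq (.add 19 1 2) <|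
  forDown 5 19 (.seq (.store 3 18 17) <| .seq (.add 17 17 1) (.add 18 18 2))

/-- The table replaces multiplication. `reg 17` runs through the multiples of `n+2` and is left at
`(n+3)(n+2)`, which then serves as the number of rounds. -/
theorem runs_tablesProg (F : DirectedProfile n) :
    ∃ s, Runs tablesProg F.encode s ((n + 3) * 8 + 11) ∧ F.Tables s ∧ s.marked = ∅ := by
  let s₀ : Store := (((F.encode.setReg 2 1).setReg 4 (n + 1)).setReg 1 (n + 2)).setReg 19 (n + 3)
  have key := runs_forDown (i := 5) (c := 19) (m := n + 3) (T := 5)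
    (p := .seq (.store 3 18 17) <| .seq (.add 17 17 1) (.add 18 18 2)) (s := s₀)
    (fun v s => s.reg 1 = n + 2 ∧ s.reg 2 = 1 ∧ s.reg 3 = 0 ∧ s.reg 4 = n + 1 ∧
      s.reg 18 + v = n + 3 ∧ s.reg 17 = s.reg 18 * (n + 2) ∧ (∀ a, a ≠ 3 → s.arr a = F.encode.arr a) ∧
      ∀ k < s.reg 18, s.arr 3 k = k * (n + 2)) ?_ ?_ ?_ ?_ ?_
  · obtain ⟨s, hr, h1, h2, h3, h4, h18, h17, ha, hk⟩ := key
    refine ⟨s, ((Runs.const _ _ _).seq <| (runs_add_of_eq (v := n + 1) ?_).seq <|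
      (runs_add_of_eq (v := n + 2) ?_).seq <| (runs_add_of_eq (v := n + 3) ?_).seq hr).mono
      (by omega), ⟨h1, h2, h3, h4, by rw [h17, ← h18]; rfl, fun a h => ha a (by omega),
        fun k h => hk k (by omega)⟩, ?_⟩
    · simp [Store.setReg, encode]
    · simp [Store.setReg]
    · simp [Store.setReg]
    · ext a
      simp [Store.marked, ha 4 (by omega), encode]
  · simp [s₀, Store.setReg, encode]
  · simp [s₀, Store.setReg]
  · simp [s₀, Store.setReg, encode]
  · exact fun v s h => h.2.1
  · rintro v hv s ⟨h1, h2, h3, h4, h18, h17, ha, hk⟩ h5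
    refine ⟨_, (Runs.store _ _ _ _).seq ((runs_add_of_eq (v := s.reg 17 + (n + 2)) ?_).seq
      (runs_add_of_eq (v := s.reg 18 + 1) ?_)), ⟨?_, ?_, ?_, ?_, ?_, ?_, ?_, ?_⟩, ?_⟩
    case refine_9 =>
      intro a h
      simp [Store.setReg, Store.setArr, h, ha]
    case refine_10 =>
      intro k h
      simp only [Store.setReg, Function.update_self, Nat.lt_succ_iff_lt_or_eq] at h
      rcases h with h | rfl
      · simp [Store.setReg, Store.setArr, Function.update_of_ne h.ne, hk k h]
      · simp [Store.setReg, Store.setArr, h17]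
    case refine_8 =>
      simp [Store.setReg, Store.setArr, h17]
      ring
    all_goals
      simp [Store.setReg, Store.setArr, *]
    omega

/-- Answers if no contradiction has been derived. -/
def answerProg : Prog :=
  .seq (.load 20 3 1) <| .seq (.load 21 4 20) (.ite 21 (.const 0 0) (.const 0 1))

theorem runs_answerProg (F : DirectedProfile n) {s : Store} (hs : F.Tables s) :
    ∃ s', Runs answerProg s s' 6 ∧
      ((falsum n ∉ s.marked ∧ s'.reg 0 = 1) ∨ (falsum n ∈ s.marked ∧ s'.reg 0 = 0)) := by
  have h₁ : Runs (.load 20 3 1) s (s.setReg 20 (falsum n)) 1 :=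
    runs_load_of_eq (by rw [hs.size, hs.row _ le_rfl]; rfl)
  have h₂ : Runs (.load 21 4 20) (s.setReg 20 (falsum n))
      ((s.setReg 20 (falsum n)).setReg 21 (s.arr 4 (falsum n))) 1 :=
    runs_load_of_eq (by simp [Store.setReg])
  by_cases h : s.arr 4 (falsum n) = 0
  · exact ⟨_, h₁.seq (h₂.seq (Runs.ite_of_eq (by simp [Store.setReg, h]) (Runs.const 0 1 _))),
      .inl ⟨not_not.2 h, by simp [Store.setReg]⟩⟩
  · exact ⟨_, h₁.seq (h₂.seq (Runs.ite_of_ne (by simp [Store.setReg, h]) (Runs.const 0 0 _))),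
      .inr ⟨h, by simp [Store.setReg]⟩⟩

/-- The decision procedure for linear profiles. -/
def decisionProg : Prog :=
  .seq tablesProg (.seq (forDown 5 17 sweepProg) answerProg)

/-- If `A` is the least set that satisfies the clauses, then it contains the contradiction if and
only if the forced precedences are contradictory. -/
theorem falsum_mem_iff {F : DirectedProfile n} {A : Set ℕ}
    (hA : ∀ x y z, F.RulesAt (pairIndex x) x y z A)
    (hmin : ∀ C, (∀ x y z, F.RulesAt (pairIndex x) x y z C) → A ⊆ C) :
    falsum n ∉ A ↔ ∀ x y, F.Forced x y → F.Forced y x → x = y := by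
  rw [forall_rulesAt_iff] at hA
  constructor
  · intro h x y hxy hyx
    by_contra hne
    exact h (hA.2 x y hne (hxy _ hA.1) (hyx _ hA.1))
  · intro h hmem
    -- The numbers of the forced precedences form a model when there is no contradiction, so the
    -- least model lies inside and avoids `falsum n`.
    let C : Set ℕ := {a | ∃ x y, a = address x y ∧ F.Forced x y}
    have hC : ∀ x y, address x y ∈ C ↔ F.Forced x y := fun x y =>
      ⟨fun ⟨x', y', e, h'⟩ => by obtain ⟨rfl, rfl⟩ := address_inj e; exact h',
        fun h' => ⟨x, y, rfl, h'⟩⟩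
    obtain ⟨x, y, e, -⟩ := hmin C (forall_rulesAt_iff.2
      ⟨by simpa only [hC] using F.isClosed_forced, fun x y hne hxy hyx =>
        absurd (h x y ((hC x y).1 hxy) ((hC y x).1 hyx)) hne⟩) hmem
    exact (address_lt_falsum x y).ne' e

theorem decisionProg_correct {F : DirectedProfile n} (hF : F.IsLinear) :
    ∃ s', Runs decisionProg F.encode s' ((n + 3) * (n + 2) *
      ((n + 2) * ((n + 2) * ((n + 2) * 147 + 6) + 6) + 6) + (n + 3) * 8 + 22) ∧
      ((F.IsRealizable ∧ s'.reg 0 = 1) ∨ (¬ F.IsRealizable ∧ s'.reg 0 = 0)) := by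
  obtain ⟨s₁, hr₁, hI₁, hm₁⟩ := F.runs_tablesProg
  obtain ⟨H, hpass, hH⟩ := F.exists_pass_sweepProg
  -- All numbers up to `falsum n` form a model, so the least model has at most `(n+2)^2 + 1`
  -- elements, fewer than the `(n+3)(n+2)` rounds.
  have hB : Models {a | a < falsum n + 1} H := by
    have hlt : ∀ x y : Fin (n + 2), address x y ∈ {a | a < falsum n + 1} := fun x y =>
      (address_lt_falsum x y).trans (Nat.lt_succ_self _)
    rw [hH, forall_rulesAt_iff]
    exact ⟨by constructor <;> intros <;> exact hlt _ _, fun _ _ _ _ _ => Nat.lt_succ_self _⟩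
  obtain ⟨s₂, hr₂, hI₂, hM, hmin⟩ := Pass.saturate (i := 5) (c := 17)
    (fun s hs => ⟨hs.one, hs.zero, hs.rounds⟩) (fun s v hs => hs.setReg (by simp)) hpass hB
    (by unfold falsum; linarith) hI₁ hm₁
  obtain ⟨s₃, hr₃, h₃⟩ := F.runs_answerProg hI₂
  refine ⟨s₃, (hr₁.seq (hr₂.seq hr₃)).mono (by linarith), ?_⟩
  rw [hH] at hM
  have := falsum_mem_iff hM fun C hC => hmin C ((hH C).2 hC)
  rw [← isRealizable_iff_forced_antisymm hF] at this
  rw [← this, not_not]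
  exact h₃

end DirectedProfile

/-- Directed MinMax-Betweenness is polynomial for linear MinMax-profiles: one program decides it for
all `n ≥ 1` and all directed linear MinMax-profiles `F` on `[n] ∪ {0, n+1}`, in a number of steps
that is bounded by a polynomial in `n`. -/
theorem theorem1 :
    ∃ (p : RAM.Prog) (q : Polynomial ℕ), ∀ n : ℕ, 1 ≤ n → ∀ F : DirectedProfile n,
      F.IsLinear → RAM.DecidesWithin p F.encode (q.eval n) F.IsRealizable := by
  refine ⟨DirectedProfile.decisionProg, (.X + 3) * (.X + 2) *
    ((.X + 2) * ((.X + 2) * ((.X + 2) * 147 + 6) + 6) + 6) + (.X + 3) * 8 + 22,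
    fun n _ F hF => ?_⟩
  obtain ⟨s', ⟨k, hk, hs⟩, h⟩ := DirectedProfile.decisionProg_correct hF
  exact ⟨k, by simpa using hk, s', hs [], h⟩
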